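/- Let $K$ be a compact line, that is, a linearly ordered set which is compact in its order topology. Call $K$ \emph{$\aleph_0$-monolithic} if the closure of every countable subset of $K$ is metrizable. An \emph{order preserving metrizable quotient} of $K$ is a continuous order preserving (i.e. $x\le y \Rightarrow q(x)\le q(y)$) surjection $q:K\to L$ onto a metrizable compact line $L$; for two such quotients $q:K\to L$ and $q':K\to L'$ write $q\preceq q'$ if for all $x,y\in K$, $q'(x)=q'(y)$ implies $q(x)=q(y)$. Then $K$ is $\aleph_0$-monolithic if and only if for every order preserving metrizable quotient $q:K\to L$ the set $\{y\in L : |q^{-1}(y)|>1\}$ is countable (possibly finite or empty). Moreover, if $K$ is not $\aleph_0$-monolithic, then there is an order preserving metrizable quotient $q$ of $K$ such that for every order preserving metrizable quotient $q':K\to L'$ of $K$ with $q\preceq q'$ the set $\{y\in L' : |(q')^{-1}(y)|>1\}$ is uncountable. -/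

import Mathlib

universe u

/-- A topological space is `ℵ₀`-monolithic if the closure of each countable subset is
metrizable. (In a compact Hausdorff space, this is the same as having a countable base.) -/
def IsAleph0Monolithic (K : Type u) [TopologicalSpace K] : Prop :=
  ∀ C : Set K, C.Countable → TopologicalSpace.MetrizableSpace (closure C)

/-- `q : K → L` is an order preserving metrizable quotient of the compact line `K`: a continuous
order preserving surjection onto a metrizable line `L` (which is compact, being an image of `K`). -/
structure IsOrderMetrizableQuotient {K L : Type u}
    [LinearOrder K] [TopologicalSpace K] [LinearOrder L] [TopologicalSpace L]
    (q : K → L) : Prop where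
  orderTopology : OrderTopology L
  metrizable : TopologicalSpace.MetrizableSpace L
  continuous : Continuous q
  monotone : Monotone q
  surjective : Function.Surjective q

/-- `q ≼ q'`: the equivalence relation defined by `q'` is contained in the one defined by `q`. -/
def QuotientLE {K L L' : Type u} (q : K → L) (q' : K → L') : Prop :=
  ∀ x y : K, q' x = q' y → q x = q y

/-- The set of the points whose fiber has more than one element. -/
def nontrivialFibers {K L : Type u} (q : K → L) : Set L :=
  {y | (q ⁻¹' {y}).Nontrivial}

open Set TopologicalSpace

/-! If `K` is monolithic, lift a countable dense subset of `L` to `K`; the closure `F` of the lift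
is compact metrizable, so it has countably many clopen sets. Apart from countably many points of
`L`, each nontrivial fiber contains a gap of `F`, hence gives a clopen cut of `F`, and distinct
points give distinct cuts. Conversely, let `C` be countable with nonmetrizable closure. A weighted
sum of monotone Urysohn functions gives `q` injective on `C`, and so is every refinement. Each
fiber, being convex, then meets `closure C` in a countable set. With countably many nontrivial
fibers, only countably many pairs of `closure C` would be identified, and separating these would
metrize it. -/

/-- A compact order-closed topology on a linear order is the order topology. -/
theorem orderTopology_of_compactSpace_orderClosedTopology {L : Type*} [LinearOrder L]
    [t : TopologicalSpace L] [CompactSpace L] [OrderClosedTopology L] : OrderTopology L := by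
  refine ⟨?_⟩
  have hle : t ≤ Preorder.topology L := by
    refine le_generateFrom ?_
    rintro s ⟨a, rfl | rfl⟩
    · exact isOpen_Ioi
    · exact isOpen_Iio
  have hT2 : @T2Space L (Preorder.topology L) := by
    let := Preorder.topology L
    have : OrderTopology L := ⟨rfl⟩
    infer_instance
  refine le_antisymm hle fun s hs => ?_
  have hcl : @IsClosedMap L L t (Preorder.topology L) id :=
    @Continuous.isClosedMap L L t (Preorder.topology L) _ hT2 id (continuous_id_iff_le.2 hle)
  have h := hcl sᶜ (@IsOpen.isClosed_compl L t s hs)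
  rw [image_id] at h
  exact (@isClosed_compl_iff L (Preorder.topology L) s).1 h

/-- Monotone Urysohn lemma on a compact line. -/
theorem exists_continuous_monotone_zero_one {K : Type*} [LinearOrder K] [TopologicalSpace K]
    [OrderTopology K] [CompactSpace K] {a b : K} (hab : a < b) :
    ∃ g : K → ℝ, Continuous g ∧ Monotone g ∧ g a = 0 ∧ g b = 1 ∧ ∀ x, g x ∈ Icc (0 : ℝ) 1 := by
  obtain ⟨f, hf0, hf1, hf⟩ := exists_continuous_zero_one_of_isClosed
    (isClosed_Iic (a := a)) (isClosed_Ici (a := b)) (Iic_disjoint_Ici.2 hab.not_ge)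
  -- The running supremum of `f` over `Iic x`, written with `min x t` so that the index set does not
  -- depend on `x`.
  have hbdd : ∀ x, BddAbove ((fun t => f (min x t)) '' univ) := fun x =>
    ⟨1, by rintro _ ⟨t, -, rfl⟩; exact (hf _).2⟩
  have hne : ∀ x, ((fun t => f (min x t)) '' univ).Nonempty := fun x => ⟨_, a, trivial, rfl⟩
  have hmem : ∀ x, sSup ((fun t => f (min x t)) '' univ) ∈ Icc (0 : ℝ) 1 := fun x =>
    ⟨(hf (min x a)).1.trans (le_csSup (hbdd x) ⟨a, trivial, rfl⟩),
      csSup_le (hne x) (by rintro _ ⟨t, -, rfl⟩; exact (hf _).2)⟩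
  refine ⟨fun x => sSup ((fun t => f (min x t)) '' univ), ?_, ?_, ?_, ?_, hmem⟩
  · refine isCompact_univ.continuous_sSup (f := fun x t => f (min x t)) ?_
    change Continuous fun p : K × K => f (min p.1 p.2)
    fun_prop
  · intro x y hxy
    refine csSup_le (hne x) ?_
    rintro _ ⟨t, -, rfl⟩
    refine le_csSup (hbdd y) ⟨min x t, trivial, ?_⟩
    simp only [← min_assoc, min_eq_right hxy]
  · refine le_antisymm (csSup_le (hne a) ?_) (hmem a).1
    rintro _ ⟨t, -, rfl⟩
    exact (hf0 (min_le_left a t)).le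
  · refine le_antisymm (hmem b).2 (le_csSup (hbdd b) ⟨b, trivial, ?_⟩)
    simpa using hf1 (self_mem_Ici (a := b))

/-- A countable subset of a compact line is separated by one continuous monotone real function. -/
theorem exists_continuous_monotone_injOn {K : Type*} [LinearOrder K] [TopologicalSpace K]
    [OrderTopology K] [CompactSpace K] {C : Set K} (hC : C.Countable) :
    ∃ f : K → ℝ, Continuous f ∧ Monotone f ∧ InjOn f C := by
  let P : Set (K × K) := {p ∈ C ×ˢ C | p.1 < p.2}
  have hP : P.Countable := (hC.prod hC).mono (sep_subset _ _)
  have := hP.toEncodable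
  choose g hgc hgm hg0 hg1 hg using fun p : P => exists_continuous_monotone_zero_one p.2.2
  let u : P → ℝ := fun p => (1 / 2) ^ Encodable.encode p
  have hu : Summable u := summable_geometric_two_encode
  have hu0 : ∀ p, 0 < u p := fun p => by positivity
  have hbound : ∀ p x, ‖u p * g p x‖ ≤ u p := fun p x => by
    rw [Real.norm_of_nonneg (mul_nonneg (hu0 p).le (hg p x).1)]
    exact mul_le_of_le_one_right (hu0 p).le (hg p x).2
  have hsum : ∀ x, Summable fun p => u p * g p x := fun x => hu.of_norm_bounded (hbound · x)
  have hlt : ∀ x ∈ C, ∀ y ∈ C, x < y → ∑' p, u p * g p x < ∑' p, u p * g p y := by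
    intro x hx y hy hxy
    refine Summable.tsum_lt_tsum (i := ⟨(x, y), ⟨hx, hy⟩, hxy⟩)
      (fun p => mul_le_mul_of_nonneg_left (hgm p hxy.le) (hu0 p).le) ?_ (hsum x) (hsum y)
    exact mul_lt_mul_of_pos_left
      ((hg0 ⟨(x, y), ⟨hx, hy⟩, hxy⟩).trans_lt
        (zero_lt_one.trans_eq (hg1 ⟨(x, y), ⟨hx, hy⟩, hxy⟩).symm)) (hu0 _)
  refine ⟨fun x => ∑' p, u p * g p x,
    continuous_tsum (fun p => continuous_const.mul (hgc p)) hu hbound, fun x y hxy =>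
      (hsum x).tsum_le_tsum (fun p => mul_le_mul_of_nonneg_left (hgm p hxy) (hu0 p).le) (hsum y),
    fun x hx y hy hxy => ?_⟩
  rcases lt_trichotomy x y with h | h | h
  · exact absurd hxy (hlt x hx y hy h).ne
  · exact h
  · exact absurd hxy (hlt y hy x hx h).ne'

/-- A continuous monotone real function on a compact line, corestricted to its range, is an order
preserving metrizable quotient. -/
theorem isOrderMetrizableQuotient_rangeFactorization {K : Type u} [LinearOrder K]
    [TopologicalSpace K] [CompactSpace K] {f : K → ℝ} (hc : Continuous f) (hm : Monotone f) :
    IsOrderMetrizableQuotient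
      (fun x => (ULift.up (rangeFactorization f x) : ULift.{u} (range f))) := by
  have : CompactSpace (range f) := isCompact_iff_compactSpace.1 (isCompact_range hc)
  have hval : Continuous fun z : ULift.{u} (range f) => (z.down : ℝ) :=
    continuous_subtype_val.comp continuous_uliftDown
  have : OrderClosedTopology (ULift.{u} (range f)) :=
    ⟨(isClosed_le_prod (α := ℝ)).preimage (hval.prodMap hval)⟩
  exact
    { orderTopology := orderTopology_of_compactSpace_orderClosedTopology
      metrizable := Topology.IsEmbedding.uliftDown.metrizableSpace
      continuous := continuous_uliftUp.comp (hc.subtype_mk _)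
      monotone := fun _ _ h => hm h
      surjective := ULift.up_surjective.comp rangeFactorization_surjective }

/-- A compact Hausdorff space is metrizable if it has a continuous map to a metrizable space that
identifies only countably many pairs of distinct points. -/
theorem metrizableSpace_of_countable_identified_pairs {X M : Type*} [TopologicalSpace X]
    [CompactSpace X] [T2Space X] [TopologicalSpace M] [MetrizableSpace M] {φ : X → M}
    (hφ : Continuous φ) (hP : {p : X × X | p.1 ≠ p.2 ∧ φ p.1 = φ p.2}.Countable) :
    MetrizableSpace X := by
  let P := {p : X × X | p.1 ≠ p.2 ∧ φ p.1 = φ p.2}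
  have : Countable P := hP.to_subtype
  choose g hg0 hg1 _ using fun p : P => exists_continuous_zero_one_of_isClosed
    (isClosed_singleton (x := p.1.1)) (isClosed_singleton (x := p.1.2))
    (disjoint_singleton.2 p.2.1)
  let Φ : X → M × (P → ℝ) := fun x => (φ x, fun p => g p x)
  have hΦ : Continuous Φ := by fun_prop
  refine (hΦ.isClosedEmbedding fun x y hxy => ?_).isEmbedding.metrizableSpace
  by_contra hne
  have h := congr_fun (congr_arg Prod.snd hxy) ⟨(x, y), hne, congr_arg Prod.fst hxy⟩
  have h0 := hg0 ⟨(x, y), hne, congr_arg Prod.fst hxy⟩ rfl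
  have h1 := hg1 ⟨(x, y), hne, congr_arg Prod.fst hxy⟩ rfl
  simp only [Φ] at h
  simp only [h, h1] at h0
  exact one_ne_zero h0

/-- A compact second countable space has only countably many clopen subsets. -/
theorem countable_setOf_isClopen {X : Type*} [TopologicalSpace X] [CompactSpace X]
    [SecondCountableTopology X] : {s : Set X | IsClopen s}.Countable := by
  have h : ∀ s : {s : Set X | IsClopen s}, ∃ t : Finset (countableBasis X),
      s.1 = (SetLike.coe t).sUnion := fun s =>
    eq_sUnion_finset_of_isTopologicalBasis_of_isCompact_open _ (isBasis_countableBasis X) s.1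
      s.2.1.isCompact s.2.2
  choose F hF using h
  have hinj : F.Injective := fun s t hst => Subtype.ext <| by rw [hF s, hF t, hst]
  exact countable_coe_iff.1 hinj.countable

/-- If a countable set `C` meets a convex set `A` in at most one point, then its closure meets `A`
in a countable set. -/
theorem countable_closure_inter_of_ordConnected {K : Type*} [LinearOrder K] [TopologicalSpace K]
    [OrderTopology K] {C A : Set K} (hC : C.Countable) (hA : A.OrdConnected)
    (hCA : (C ∩ A).Subsingleton) : (closure C ∩ A).Countable := by
  have hleast : {x | IsLeast A x}.Subsingleton := fun _ hx _ hy => hx.unique hy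
  have hgreatest : {x | IsGreatest A x}.Subsingleton := fun _ hx _ hy => hx.unique hy
  -- A point of `closure C ∩ A` outside `C` must be an endpoint of `A`: near an interior one, `C ∩
  -- A` would have two points.
  refine ((hC.union hleast.countable).union hgreatest.countable).mono ?_
  rintro x ⟨hxC, hxA⟩
  by_contra hx
  simp only [mem_union, not_or, mem_ofPred_eq, IsLeast, IsGreatest, hxA, true_and, mem_lowerBounds,
    mem_upperBounds, not_forall, not_le, exists_prop] at hx
  obtain ⟨⟨hx, u, hu, hux⟩, v, hv, hxv⟩ := hx
  have key : ∀ u ∈ A, ∀ v ∈ A, u < x → x < v → ∃ c ∈ C ∩ A, c ∈ Ioo u v := by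
    intro u hu v hv hux hxv
    obtain ⟨c, hc, hcC⟩ := mem_closure_iff.1 hxC _ isOpen_Ioo ⟨hux, hxv⟩
    exact ⟨c, ⟨hcC, hA.out hu hv (Ioo_subset_Icc_self hc)⟩, hc⟩
  obtain ⟨c, hc, huc, hcv⟩ := key u hu v hv hux hxv
  rcases lt_trichotomy c x with h | rfl | h
  · obtain ⟨d, hd, hcd, -⟩ := key c hc.2 v hv h hxv
    exact hcd.ne (hCA hc hd)
  · exact hx hc.1
  · obtain ⟨d, hd, -, hdc⟩ := key u hu c hc.2 hux h
    exact hdc.ne (hCA hd hc)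

/-- If a metrizable quotient with countably many nontrivial fibers is injective on a countable set,
then the closure of that set is metrizable. -/
theorem IsOrderMetrizableQuotient.metrizableSpace_closure {K L : Type u} [LinearOrder K]
    [TopologicalSpace K] [OrderTopology K] [CompactSpace K] [LinearOrder L] [TopologicalSpace L]
    {q : K → L} (hq : IsOrderMetrizableQuotient q) (hN : (nontrivialFibers q).Countable)
    {C : Set K} (hC : C.Countable) (hinj : InjOn q C) : MetrizableSpace (closure C) := by
  have := hq.metrizable
  have : CompactSpace (closure C) := isCompact_iff_compactSpace.1 isClosed_closure.isCompact
  refine metrizableSpace_of_countable_identified_pairs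
    (hq.continuous.comp continuous_subtype_val) ?_
  have hfib : ∀ y, (closure C ∩ q ⁻¹' {y}).Countable := fun y =>
    countable_closure_inter_of_ordConnected hC (ordConnected_singleton.preimage_mono hq.monotone)
      fun a ha b hb => hinj ha.1 hb.1 (ha.2.trans hb.2.symm)
  have hcount : (⋃ y ∈ nontrivialFibers q,
      (closure C ∩ q ⁻¹' {y}) ×ˢ (closure C ∩ q ⁻¹' {y})).Countable :=
    hN.biUnion fun y _ => (hfib y).prod (hfib y)
  refine (hcount.preimage (f := Prod.map (Subtype.val : closure C → K) Subtype.val)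
    (Subtype.val_injective.prodMap Subtype.val_injective)).mono ?_
  rintro ⟨a, b⟩ ⟨hab, hqab⟩
  have hqab : q a = q b := hqab
  refine mem_biUnion (x := q b) ⟨a, hqab, b, rfl, fun h => hab (Subtype.ext h)⟩ ?_
  exact ⟨⟨a.2, hqab⟩, b.2, rfl⟩

/-- Every metrizable quotient of an `ℵ₀`-monolithic compact line has countably many nontrivial
fibers. -/
theorem IsAleph0Monolithic.countable_nontrivialFibers {K L : Type u} [LinearOrder K]
    [TopologicalSpace K] [OrderTopology K] [CompactSpace K] [LinearOrder L] [TopologicalSpace L]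
    (hK : IsAleph0Monolithic K) {q : K → L} (hq : IsOrderMetrizableQuotient q) :
    (nontrivialFibers q).Countable := by
  rcases isEmpty_or_nonempty K with _ | _
  · have := hq.surjective.countable
    exact to_countable _
  have := hq.metrizable
  have := hq.orderTopology
  have : CompactSpace L := hq.surjective.compactSpace hq.continuous
  let := metrizableSpaceMetric L
  obtain ⟨D, hD, hDd⟩ := exists_countable_dense L
  obtain ⟨s, hs⟩ := hq.surjective.hasRightInverse
  let F := closure (s '' D)
  have : MetrizableSpace F := hK _ (hD.image s)
  have : CompactSpace F := isCompact_iff_compactSpace.1 isClosed_closure.isCompact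
  let := metrizableSpaceMetric F
  -- Off `D`, the lift misses the fiber; without a jump to the right of `y`, `D` separates `y` from
  -- larger points.
  let S := nontrivialFibers q \ (D ∪ {y : L | ∃ z, y ⋖ z})
  suffices hS : S.Countable from
    hS.of_sdiff (hD.union countable_setOfPred_covBy_right)
  have hpair : ∀ y ∈ S, ∃ a b, a < b ∧ q a = y ∧ q b = y := by
    rintro y ⟨hy, -⟩
    obtain ⟨a, ha, b, hb, hab⟩ := hy.exists_lt
    exact ⟨a, b, hab, ha, hb⟩
  choose! a b hab ha hb using hpair
  have hgap : ∀ y ∈ S, ∀ z ∈ F, z ∉ Ioo (a y) (b y) := by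
    intro y hy z hz hzI
    obtain ⟨_, hc, d, hd, rfl⟩ := mem_closure_iff.1 hz _ isOpen_Ioo hzI
    have h1 := hq.monotone hc.1.le
    have h2 := hq.monotone hc.2.le
    rw [hs d, ha y hy] at h1
    rw [hs d, hb y hy] at h2
    exact hy.2 (Or.inl (le_antisymm h1 h2 ▸ hd))
  let V : L → Set F := fun y => {z | (z : K) ≤ a y}
  have hV : MapsTo V S {U | IsClopen U} := by
    intro y hy
    refine ⟨isClosed_Iic.preimage continuous_subtype_val, ?_⟩
    have : V y = Subtype.val ⁻¹' Iio (b y) := by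
      ext z
      refine ⟨fun h => lt_of_le_of_lt h (hab y hy), fun h => ?_⟩
      by_contra h'
      exact hgap y hy z z.2 ⟨not_le.1 h', h⟩
    rw [this]
    exact isOpen_Iio.preimage continuous_subtype_val
  have hne : ∀ y ∈ S, ∀ y' ∈ S, y < y' → V y ≠ V y' := by
    intro y hy y' hy' hlt heq
    have hI : (Ioo y y').Nonempty := by
      by_contra hI
      exact hy.2 (Or.inr ⟨y', hlt, fun z h1 h2 => hI ⟨z, h1, h2⟩⟩)
    -- As `y < d < y'`, the lift `s d` lies in `V y'` but not in `V y`.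
    obtain ⟨d, hdI, hd⟩ := hDd.inter_open_nonempty _ isOpen_Ioo hI
    let z : F := ⟨s d, subset_closure ⟨d, hd, rfl⟩⟩
    have h1 : z ∈ V y' := by
      by_contra h
      have := hq.monotone (not_le.1 h).le
      rw [ha y' hy', hs d] at this
      exact hdI.2.not_ge this
    rw [← heq] at h1
    have := hq.monotone h1
    rw [ha y hy, hs d] at this
    exact hdI.1.not_ge this
  refine hV.countable_of_injOn (fun y hy y' hy' h => ?_) countable_setOf_isClopen
  rcases lt_trichotomy y y' with hlt | heq | hlt
  · exact absurd h (hne y hy y' hy' hlt)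
  · exact heq
  · exact absurd h.symm (hne y' hy' y hy hlt)

/-- A compact line that is not `ℵ₀`-monolithic has a metrizable quotient all of whose metrizable
refinements have uncountably many nontrivial fibers. -/
theorem exists_quotient_forall_refinement_not_countable {K : Type u} [LinearOrder K]
    [TopologicalSpace K] [OrderTopology K] [CompactSpace K] (hK : ¬ IsAleph0Monolithic K) :
    ∃ (L : Type u) (_ : LinearOrder L) (_ : TopologicalSpace L) (q : K → L),
      IsOrderMetrizableQuotient q ∧
      ∀ (L' : Type u) [LinearOrder L'] [TopologicalSpace L'] (q' : K → L'),
        IsOrderMetrizableQuotient q' → QuotientLE q q' →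
          ¬ (nontrivialFibers q').Countable := by
  simp only [IsAleph0Monolithic, not_forall, exists_prop] at hK
  obtain ⟨C, hC, hCm⟩ := hK
  obtain ⟨f, hfc, hfm, hinj⟩ := exists_continuous_monotone_injOn hC
  refine ⟨ULift.{u} (range f), inferInstance, inferInstance, _,
    isOrderMetrizableQuotient_rangeFactorization hfc hfm, fun L' _ _ q' hq' hle hN => hCm ?_⟩
  refine hq'.metrizableSpace_closure hN hC fun x hx y hy hxy => hinj hx hy ?_
  exact congr_arg (fun z : ULift.{u} (range f) => (z.down : ℝ)) (hle x y hxy)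

theorem mainTheorem9 (K : Type u) [LinearOrder K] [TopologicalSpace K] [OrderTopology K]
    [CompactSpace K] :
    (IsAleph0Monolithic K ↔
      ∀ (L : Type u) [LinearOrder L] [TopologicalSpace L] (q : K → L),
        IsOrderMetrizableQuotient q → (nontrivialFibers q).Countable) ∧
    (¬ IsAleph0Monolithic K →
      ∃ (L : Type u) (_ : LinearOrder L) (_ : TopologicalSpace L) (q : K → L),
        IsOrderMetrizableQuotient q ∧
        ∀ (L' : Type u) [LinearOrder L'] [TopologicalSpace L'] (q' : K → L'),
          IsOrderMetrizableQuotient q' → QuotientLE q q' →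
            ¬ (nontrivialFibers q').Countable) := by
  refine ⟨⟨fun hK L _ _ q hq => hK.countable_nontrivialFibers hq, fun h => ?_⟩,
    exists_quotient_forall_refinement_not_countable⟩
  by_contra hK
  obtain ⟨L, _, _, q, hq, hq'⟩ := exists_quotient_forall_refinement_not_countable hK
  -- `q` refines itself.
  exact hq' L q hq (fun _ _ hxy => hxy) (h L q hq)
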